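/- Let $n$ be a natural number, let $\mathcal{E}$ be a complex Hilbert space, and let $\mathbb{T}^n$ carry the normalized Lebesgue measure. Let $L^2_{\mathcal{E}}(\mathbb{T}^n)$ be the space of square-integrable $\mathcal{E}$-valued functions, and let $H^2_{\mathcal{E}}(\mathbb{D}^n)$ be the Hardy space, identified through radial limits with the closed subspace $\{\sum_{k\in\mathbb{N}^n} a_k z^k : a_k\in\mathcal{E},\ \sum_k\|a_k\|^2<\infty\}$ of $L^2_{\mathcal{E}}(\mathbb{T}^n)$. Let $\Phi\in L^\infty_{\mathcal{B}(\mathcal{E})}(\mathbb{T}^n)$, that is, $\Phi:\mathbb{T}^n\to\mathcal{B}(\mathcal{E})$ is essentially bounded in operator norm and measurable; for separable $\mathcal{E}$, measurable means that $z\mapsto\langle\Phi(z)x,y\rangle$ is measurable for all $x,y\in\mathcal{E}$, and for non-separable $\mathcal{E}$ it means Bochner measurable in the operator norm. Let $T_\Phi=P_{H^2_{\mathcal{E}}(\mathbb{D}^n)}L_\Phi|_{H^2_{\mathcal{E}}(\mathbb{D}^n)}$ be the Toeplitz operator with symbol $\Phi$, where $L_\Phi$ is multiplication by $\Phi$ on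 $L^2_{\mathcal{E}}(\mathbb{T}^n)$. A bounded operator is called a partial isometry if it is isometric on the orthogonal complement of its kernel. If $T_\Phi$ is a partial isometry on $H^2_{\mathcal{E}}(\mathbb{D}^n)$, then $\Phi(z)$ is a partial isometry on $\mathcal{E}$ for almost every $z\in\mathbb{T}^n$. -/

import Mathlib

open MeasureTheory Filter Topology
open scoped ENNReal

noncomputable section

namespace ToeplitzPolydisc

/-- The `n`-torus `𝕋ⁿ`, parametrized by angles: the point `x` of `(ℝ/ℤ)ⁿ` stands for
`z = (e^{2πi x₁}, …, e^{2πi xₙ})`. -/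
abbrev Torus (n : ℕ) : Type := UnitAddTorus (Fin n)

/-- The normalized Lebesgue measure on `𝕋ⁿ`. -/
abbrev torusMeasure (n : ℕ) : Measure (Torus n) :=
  Measure.pi fun _ => AddCircle.haarAddCircle

/-- A bounded operator is a partial isometry if it is isometric on the orthogonal complement of
its kernel. -/
def IsPartialIsometry {H K : Type*} [NormedAddCommGroup H] [InnerProductSpace ℂ H]
    [NormedAddCommGroup K] [InnerProductSpace ℂ K] (T : H →L[ℂ] K) : Prop :=
  ∀ x ∈ (LinearMap.ker (T : H →ₗ[ℂ] K))ᗮ, ‖T x‖ = ‖x‖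

section Spaces

variable (n : ℕ) (E : Type*) [NormedAddCommGroup E] [InnerProductSpace ℂ E]

/-- The space `L²_E(𝕋ⁿ)`. -/
abbrev L2 : Type _ := Lp E 2 (torusMeasure n)

variable {n E}

/-- The analytic monomial `z ↦ z^k η` with `k ∈ ℕⁿ` and `η ∈ E`, as an element of `L²_E(𝕋ⁿ)`. -/
def analyticMonomial (k : Fin n → ℕ) (η : E) : L2 n E :=
  ContinuousMap.toLp (E := E) 2 (torusMeasure n) ℂ
    ⟨fun z => UnitAddTorus.mFourier (fun i => (k i : ℤ)) z • η, by fun_prop⟩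

variable (n E)

/-- The Hardy space `H²_E(𝔻ⁿ)`, identified through radial limits with the closed subspace
`H²_E(𝕋ⁿ)` of `L²_E(𝕋ⁿ)`. Since the spaces `{z^k η : η ∈ E}` are mutually orthogonal and
`‖z^k η‖ = ‖η‖`, the closed span of the analytic monomials consists exactly of the boundary
functions `∑_{k ∈ ℕⁿ} z^k a_k` with `∑ ‖a_k‖² < ∞`. -/
def hardySpace : Submodule ℂ (L2 n E) :=
  (Submodule.span ℂ {f | ∃ (k : Fin n → ℕ) (η : E), f = analyticMonomial k η}).topologicalClosure

variable {n E}

/-- `Φ` belongs to `L^∞_{B(E)}(𝕋ⁿ)`: it is essentially bounded in operator norm, and it is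
measurable. Measurability means weak measurability of all matrix entries when `E` is separable
(the usual meaning for operator-valued functions, weaker than norm measurability), and Bochner
measurability in the operator norm when `E` is arbitrary. -/
structure MemLInfty (Φ : Torus n → E →L[ℂ] E) : Prop where
  measurable : AEStronglyMeasurable Φ (torusMeasure n) ∨
    (TopologicalSpace.SeparableSpace E ∧
      ∀ x y : E, AEMeasurable (fun z => inner ℂ (Φ z x) y) (torusMeasure n))
  bounded : ∃ C : ℝ, ∀ᵐ z ∂(torusMeasure n), ‖Φ z‖ ≤ C

/-- A weakly measurable function into a separable Hilbert space is strongly measurable. -/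
lemma aestronglyMeasurable_of_inner {α : Type*} [MeasurableSpace α] {μ : Measure α}
    [TopologicalSpace.SeparableSpace E] {g : α → E}
    (hg : ∀ y : E, AEMeasurable (fun z => inner ℂ (g z) y) μ) : AEStronglyMeasurable g μ := by
  classical
  let U : ℕ → Submodule ℂ E := fun m =>
    Submodule.span ℂ ((Finset.range m).image (TopologicalSpace.denseSeq E) : Set E)
  have hfin : ∀ m, FiniteDimensional ℂ (U m) := fun m =>
    FiniteDimensional.span_of_finite ℂ (Finset.finite_toSet _)
  have hmono : Monotone U := fun a b hab =>
    Submodule.span_mono (by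
      exact_mod_cast Finset.image_subset_image (Finset.range_subset_range.2 hab))
  have htop : (⊤ : Submodule ℂ E) ≤ (⨆ m, U m).topologicalClosure := by
    intro x _
    have hx : x ∈ closure (Set.range (TopologicalSpace.denseSeq E)) :=
      TopologicalSpace.denseRange_denseSeq E x
    refine closure_mono ?_ hx
    rintro _ ⟨j, rfl⟩
    refine Submodule.mem_iSup_of_mem (j + 1) (Submodule.subset_span ?_)
    exact Finset.mem_coe.2 (Finset.mem_image_of_mem _ (Finset.mem_range.2 (Nat.lt_succ_self j)))
  refine aestronglyMeasurable_of_tendsto_ae (u := atTop)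
    (f := fun m z => (U m).starProjection (g z)) ?_ ?_
  · intro m
    have : (fun z => (U m).starProjection (g z)) = fun z =>
        ∑ i, inner ℂ ((stdOrthonormalBasis ℂ (U m) i : U m) : E) (g z) •
          ((stdOrthonormalBasis ℂ (U m) i : U m) : E) := by
      funext z
      rw [Submodule.starProjection_apply,
        (stdOrthonormalBasis ℂ (U m)).orthogonalProjectionOnto_apply_eq_sum]
      simp
    rw [this]
    refine Finset.aestronglyMeasurable_fun_sum _ fun i _ => ?_
    refine AEStronglyMeasurable.smul_const ?_ _
    have h := (hg ((stdOrthonormalBasis ℂ (U m) i : U m) : E)).aestronglyMeasurable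
    have h2 := Complex.continuous_conj.comp_aestronglyMeasurable h
    refine h2.congr (Eventually.of_forall fun z => ?_)
    simp
  · exact Eventually.of_forall fun z => Submodule.starProjection_tendsto_self U hmono (g z) htop

end Spaces

section Operators

variable {n : ℕ} {E : Type*} [NormedAddCommGroup E] [InnerProductSpace ℂ E]

/-- `z ↦ Φ(z) f(z)` is measurable when `Φ` is a symbol and `f` is measurable. -/
lemma MemLInfty.aestronglyMeasurable_apply {Φ : Torus n → E →L[ℂ] E} (hΦ : MemLInfty Φ)
    {f : Torus n → E} (hf : AEStronglyMeasurable f (torusMeasure n)) :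
    AEStronglyMeasurable (fun z => Φ z (f z)) (torusMeasure n) := by
  have hc : ∀ x : E, AEStronglyMeasurable (fun z => Φ z x) (torusMeasure n) := by
    intro x
    rcases hΦ.measurable with h | ⟨hs, h⟩
    · exact (ContinuousLinearMap.apply ℂ E x).continuous.comp_aestronglyMeasurable h
    · exact aestronglyMeasurable_of_inner (h x)
  obtain ⟨g, hg, hfg⟩ := hf
  suffices AEStronglyMeasurable (fun z => Φ z (g z)) (torusMeasure n) from
    this.congr (hfg.mono fun z hz => by simp only [hz])
  refine aestronglyMeasurable_of_tendsto_ae (u := atTop)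
    (f := fun m z => Φ z (hg.approx m z)) ?_ ?_
  · intro m
    have : (fun z => Φ z (hg.approx m z)) = fun z =>
        ∑ y ∈ (hg.approx m).range,
          ((hg.approx m) ⁻¹' {y}).indicator (fun z => Φ z y) z := by
      funext z
      classical
      simp only [Set.indicator_apply, Set.mem_preimage, Set.mem_singleton_iff]
      rw [Finset.sum_ite_eq, if_pos (SimpleFunc.mem_range_self _ z)]
    rw [this]
    exact Finset.aestronglyMeasurable_fun_sum _ fun y _ =>
      (hc y).indicator ((hg.approx m).measurableSet_fiber y)
  · exact Eventually.of_forall fun z =>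
      ((Φ z).continuous.tendsto _).comp (hg.tendsto_approx z)

lemma MemLInfty.memLp_apply {Φ : Torus n → E →L[ℂ] E} (hΦ : MemLInfty Φ) (f : L2 n E) :
    MemLp (fun z => Φ z (f z)) 2 (torusMeasure n) := by
  obtain ⟨C, hC⟩ := hΦ.bounded
  refine (Lp.memLp f).of_le_mul (c := C)
    (hΦ.aestronglyMeasurable_apply (Lp.aestronglyMeasurable f)) ?_
  filter_upwards [hC] with z hz
  exact ((Φ z).le_opNorm _).trans (mul_le_mul_of_nonneg_right hz (norm_nonneg _))

/-- The Laurent operator `L_Φ` on `L²_E(𝕋ⁿ)`: `(L_Φ f)(z) = Φ(z) f(z)` almost everywhere. -/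
def laurent (Φ : Torus n → E →L[ℂ] E) (hΦ : MemLInfty Φ) : L2 n E →L[ℂ] L2 n E :=
  LinearMap.mkContinuousOfExistsBound
    { toFun := fun f => (hΦ.memLp_apply f).toLp _
      map_add' := fun f g => by
        rw [← MemLp.toLp_add]
        refine MemLp.toLp_congr _ _ ?_
        filter_upwards [Lp.coeFn_add f g] with z hz
        exact (congrArg (Φ z) hz).trans (map_add (Φ z) (f z) (g z))
      map_smul' := fun c f => by
        rw [RingHom.id_apply, ← MemLp.toLp_const_smul]
        refine MemLp.toLp_congr _ _ ?_
        filter_upwards [Lp.coeFn_smul c f] with z hz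
        exact (congrArg (Φ z) hz).trans (map_smul (Φ z) c (f z)) } (by
    obtain ⟨C, hC⟩ := hΦ.bounded
    refine ⟨C, fun f => Lp.norm_le_mul_norm_of_ae_le_mul ?_⟩
    filter_upwards [hC, (hΦ.memLp_apply f).coeFn_toLp] with z hz hz'
    refine (congrArg norm hz').le.trans ?_
    exact ((Φ z).le_opNorm _).trans (mul_le_mul_of_nonneg_right hz (norm_nonneg _)))

variable [CompleteSpace E]

instance : CompleteSpace (hardySpace n E) :=
  (Submodule.isClosed_topologicalClosure _).completeSpace_coe

/-- The Toeplitz operator `T_Φ = P_{H²} L_Φ |_{H²}` on `H²_E`, with symbol `Φ`. -/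
def toeplitz (Φ : Torus n → E →L[ℂ] E) (hΦ : MemLInfty Φ) :
    hardySpace n E →L[ℂ] hardySpace n E :=
  (hardySpace n E).orthogonalProjectionOnto ∘L laurent Φ hΦ ∘L (hardySpace n E).subtypeL

end Operators

end ToeplitzPolydisc

end

/-! A bounded operator `T` is a partial isometry exactly when `T T* T = T`, an identity that can be
tested on vectors. Multiplication by `(z₁ ⋯ zₙ)^m` is isometric, commutes with every `L_Φ`, and
pushes each `L²` function into `H²` up to an error tending to `0`
(`tendsto_starProjection_shift_sub`). So on far-shifted vectors the projection in `T_Φ` becomes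
negligible, and since `T_Φ* = T_{Φ*}`, the identity for `T_Φ` passes to `L_Φ` on constant functions
(`laurent_adjoint_laurent_const`). Pointwise this says that, for each vector `x`, `Φ(z) Φ(z)* Φ(z) x
= Φ(z) x` for almost every `z`. It remains to find one null set serving all `x`. -/

noncomputable section

namespace ToeplitzPolydisc

/-! ### Algebraic characterization of partial isometries. -/

section PartialIsometry

variable {H : Type*} [NormedAddCommGroup H] [InnerProductSpace ℂ H] [CompleteSpace H]

/-- A bounded operator with `T T* T = T` is a partial isometry. -/
lemma isPartialIsometry_of_apply_adjoint_apply {T : H →L[ℂ] H}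
    (h : ∀ x, T (ContinuousLinearMap.adjoint T (T x)) = T x) : IsPartialIsometry T := by
  intro x hx
  have hk : ContinuousLinearMap.adjoint T (T x) - x ∈ LinearMap.ker (T : H →ₗ[ℂ] H) := by
    simp [LinearMap.mem_ker, h x]
  have h0 : inner ℂ (ContinuousLinearMap.adjoint T (T x) - x) x = 0 := hx _ hk
  rw [inner_sub_left, ContinuousLinearMap.adjoint_inner_left, inner_self_eq_norm_sq_to_K,
    inner_self_eq_norm_sq_to_K, sub_eq_zero] at h0
  have h1 : ‖T x‖ ^ 2 = ‖x‖ ^ 2 := by exact_mod_cast h0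
  exact (sq_eq_sq₀ (norm_nonneg _) (norm_nonneg _)).1 h1

/-- A partial isometry satisfies `T T* T = T`. -/
lemma IsPartialIsometry.apply_adjoint_apply {T : H →L[ℂ] H} (hT : IsPartialIsometry T) (x : H) :
    T (ContinuousLinearMap.adjoint T (T x)) = T x := by
  set K : Submodule ℂ H := LinearMap.ker (T : H →ₗ[ℂ] H) with hK
  have hKc : IsClosed (K : Set H) := T.isClosed_ker
  have : CompleteSpace K := hKc.completeSpace_coe
  have hTQ : ∀ y, T (Kᗮ.starProjection y) = T y := by
    intro y
    have h1 : T (K.starProjection y) = 0 := K.starProjection_apply_mem y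
    have h2 := K.starProjection_add_starProjection_orthogonal y
    conv_rhs => rw [← h2, map_add, h1, zero_add]
  -- Over `ℂ` an operator is determined by its quadratic form; here both forms equal `‖T y‖²`.
  have hop : ((ContinuousLinearMap.adjoint T ∘L T : H →L[ℂ] H) : H →ₗ[ℂ] H)
      = (Kᗮ.starProjection : H →ₗ[ℂ] H) := by
    rw [← ext_inner_map]
    intro y
    have h1 : inner ℂ (Kᗮ.starProjection y) y
        = inner ℂ (Kᗮ.starProjection y) (Kᗮ.starProjection y) := by
      rw [← Submodule.inner_starProjection_left_eq_right]
      congr 1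
      exact (Submodule.starProjection_eq_self_iff.2 (Kᗮ.starProjection_apply_mem y)).symm
    change inner ℂ (ContinuousLinearMap.adjoint T (T y)) y = inner ℂ (Kᗮ.starProjection y) y
    rw [h1, ContinuousLinearMap.adjoint_inner_left, inner_self_eq_norm_sq_to_K,
      inner_self_eq_norm_sq_to_K, ← hT _ (Kᗮ.starProjection_apply_mem y), hTQ]
  have hx : ContinuousLinearMap.adjoint T (T x) = Kᗮ.starProjection x :=
    LinearMap.congr_fun hop x
  rw [hx, hTQ]

end PartialIsometry

/-! ### Laurent operators, trigonometric polynomials and shifts. -/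

section Laurent

variable {n : ℕ} {E : Type*} [NormedAddCommGroup E] [InnerProductSpace ℂ E]

lemma coeFn_laurent {Φ : Torus n → E →L[ℂ] E} (hΦ : MemLInfty Φ) (f : L2 n E) :
    laurent Φ hΦ f =ᵐ[torusMeasure n] fun z => Φ z (f z) :=
  (hΦ.memLp_apply f).coeFn_toLp

lemma laurent_comm {Φ Ψ : Torus n → E →L[ℂ] E} (hΦ : MemLInfty Φ) (hΨ : MemLInfty Ψ)
    (h : ∀ z, Commute (Φ z) (Ψ z)) (f : L2 n E) :
    laurent Φ hΦ (laurent Ψ hΨ f) = laurent Ψ hΨ (laurent Φ hΦ f) := by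
  refine Lp.ext ?_
  filter_upwards [coeFn_laurent hΦ (laurent Ψ hΨ f), coeFn_laurent hΨ (laurent Φ hΦ f),
    coeFn_laurent hΦ f, coeFn_laurent hΨ f] with z h1 h2 h3 h4
  rw [h1, h2, h3, h4]
  exact DFunLike.congr_fun (h z) (f z)

/-- The trigonometric monomial `z ↦ z^k η` with `k ∈ ℤⁿ`. -/
def fourierMonomial (k : Fin n → ℤ) (η : E) : L2 n E :=
  ContinuousMap.toLp (E := E) 2 (torusMeasure n) ℂ
    ⟨fun z => UnitAddTorus.mFourier k z • η, by fun_prop⟩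

lemma coeFn_fourierMonomial (k : Fin n → ℤ) (η : E) :
    fourierMonomial k η =ᵐ[torusMeasure n] fun z => UnitAddTorus.mFourier k z • η :=
  ContinuousMap.coeFn_toLp _ _

lemma fourierMonomial_mem_hardySpace {k : Fin n → ℤ} (hk : ∀ i, 0 ≤ k i) (η : E) :
    fourierMonomial k η ∈ hardySpace n E := by
  refine Submodule.le_topologicalClosure _ (Submodule.subset_span ⟨fun i => (k i).toNat, η, ?_⟩)
  have : (fun i => ((k i).toNat : ℤ)) = k := funext fun i => Int.toNat_of_nonneg (hk i)
  simp only [analyticMonomial, this]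
  rfl

/-- The trigonometric polynomials with coefficients in `E` are dense in `L²_E(𝕋ⁿ)`. -/
lemma topologicalClosure_span_fourierMonomial :
    (Submodule.span ℂ {f : L2 n E | ∃ k η, f = fourierMonomial k η}).topologicalClosure = ⊤ := by
  set S := (Submodule.span ℂ {f : L2 n E | ∃ k η, f = fourierMonomial k η}).topologicalClosure
    with hS
  have hSc : IsClosed (S : Set (L2 n E)) := Submodule.isClosed_topologicalClosure _
  -- Scalar Fourier density, carried over along `g ↦ g η`; indicators times vectors are of this
  -- form, and they generate `L²_E`.
  have hscal : ∀ (η : E) (g : Lp ℂ 2 (torusMeasure n)),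
      (ContinuousLinearMap.toSpanSingleton ℂ η).compLpL 2 (torusMeasure n) g ∈ S := by
    intro η g
    set J := (ContinuousLinearMap.toSpanSingleton ℂ η).compLpL 2 (torusMeasure n) with hJ
    have hJc : IsClosed ((S.comap (J : Lp ℂ 2 (torusMeasure n) →ₗ[ℂ] L2 n E) :
        Submodule ℂ (Lp ℂ 2 (torusMeasure n))) : Set (Lp ℂ 2 (torusMeasure n))) :=
      hSc.preimage J.continuous
    have hd := UnitAddTorus.span_mFourierLp_closure_eq_top (d := Fin n) (p := 2) (by simp)
    have hle : (Submodule.span ℂ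
        (Set.range (UnitAddTorus.mFourierLp (d := Fin n) 2))).topologicalClosure ≤
        S.comap (J : Lp ℂ 2 (torusMeasure n) →ₗ[ℂ] L2 n E) := by
      refine Submodule.topologicalClosure_minimal _ (Submodule.span_le.2 ?_) hJc
      rintro _ ⟨k, rfl⟩
      refine Submodule.le_topologicalClosure _ (Submodule.subset_span ⟨k, η, ?_⟩)
      refine Lp.ext ?_
      filter_upwards [coeFn_fourierMonomial k η, UnitAddTorus.coeFn_mFourierLp 2 k,
        (ContinuousLinearMap.toSpanSingleton ℂ η).coeFn_compLpL
          (UnitAddTorus.mFourierLp (d := Fin n) 2 k)] with z h1 h2 h3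
      refine Eq.trans h3 ?_
      rw [h1, h2, ContinuousLinearMap.toSpanSingleton_apply]
    exact (hd ▸ hle) (Submodule.mem_top (x := g))
  rw [eq_top_iff]
  rintro f -
  refine Lp.induction (p := 2) (by simp) (motive := fun f => f ∈ S) ?_ ?_ hSc f
  · intro c s hs hμs
    have h := hscal c (indicatorConstLp 2 hs hμs.ne 1)
    rw [Lp.simpleFunc.coe_indicatorConst]
    convert! h using 1
    refine Lp.ext ?_
    filter_upwards [indicatorConstLp_coeFn (p := 2) (hs := hs) (hμs := hμs.ne) (c := c),
      indicatorConstLp_coeFn (p := 2) (hs := hs) (hμs := hμs.ne) (c := (1 : ℂ)),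
      (ContinuousLinearMap.toSpanSingleton ℂ c).coeFn_compLpL
        (indicatorConstLp 2 hs hμs.ne (1 : ℂ))] with z h1 h2 h3
    rw [h1, h3, h2]
    by_cases hz : z ∈ s <;> simp [hz]
  · intro f g _ _ _ hf hg
    exact S.add_mem hf hg

/-- The symbol `z ↦ (z₁ ⋯ zₙ)^m I`. -/
def shiftSymbol (E : Type*) [NormedAddCommGroup E] [InnerProductSpace ℂ E] (m : ℕ) :
    Torus n → E →L[ℂ] E :=
  fun z => UnitAddTorus.mFourier (fun _ => (m : ℤ)) z • ContinuousLinearMap.id ℂ E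

lemma norm_mFourier_apply (k : Fin n → ℤ) (z : Torus n) : ‖UnitAddTorus.mFourier k z‖ = 1 := by
  simp [UnitAddTorus.mFourier, fourier_apply, Circle.norm_coe]

lemma norm_shiftSymbol_apply (m : ℕ) (z : Torus n) (x : E) : ‖shiftSymbol E m z x‖ = ‖x‖ := by
  simp [shiftSymbol, norm_smul, norm_mFourier_apply]

lemma memLInfty_shiftSymbol (m : ℕ) : MemLInfty (shiftSymbol E m : Torus n → E →L[ℂ] E) where
  measurable := by
    left
    have : Continuous (shiftSymbol E m : Torus n → E →L[ℂ] E) := by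
      unfold shiftSymbol; fun_prop
    exact this.aestronglyMeasurable
  bounded := ⟨1, Eventually.of_forall fun z =>
    ContinuousLinearMap.opNorm_le_bound _ zero_le_one fun x => by
      rw [norm_shiftSymbol_apply, one_mul]⟩

/-- Multiplication by `(z₁ ⋯ zₙ)^m` on `L²_E(𝕋ⁿ)`. -/
def shift (m : ℕ) : L2 n E →L[ℂ] L2 n E := laurent (shiftSymbol E m) (memLInfty_shiftSymbol m)

lemma norm_shift (m : ℕ) (f : L2 n E) : ‖shift m f‖ = ‖f‖ := by
  have h : ∀ᵐ z ∂torusMeasure n, ‖shift m f z‖ = ‖f z‖ := by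
    filter_upwards [coeFn_laurent (memLInfty_shiftSymbol m) f] with z hz
    exact (congrArg norm hz).trans (norm_shiftSymbol_apply m z _)
  exact le_antisymm (Lp.norm_le_norm_of_ae_le (h.mono fun _ => le_of_eq))
    (Lp.norm_le_norm_of_ae_le (h.mono fun _ hz => hz.ge))

lemma laurent_shift {Φ : Torus n → E →L[ℂ] E} (hΦ : MemLInfty Φ) (m : ℕ) (f : L2 n E) :
    laurent Φ hΦ (shift m f) = shift m (laurent Φ hΦ f) :=
  laurent_comm hΦ (memLInfty_shiftSymbol m)
    (fun z => by ext x; simp [shiftSymbol]) f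

lemma shift_fourierMonomial (m : ℕ) (k : Fin n → ℤ) (η : E) :
    shift m (fourierMonomial k η) = fourierMonomial ((fun _ => (m : ℤ)) + k) η := by
  refine Lp.ext ?_
  filter_upwards [coeFn_laurent (memLInfty_shiftSymbol m) (fourierMonomial k η),
    coeFn_fourierMonomial k η, coeFn_fourierMonomial ((fun _ => (m : ℤ)) + k) η] with z h1 h2 h3
  refine Eq.trans h1 ?_
  rw [h2, h3, UnitAddTorus.mFourier_add, mul_smul]
  rfl

end Laurent

/-! ### Asymptotics of Toeplitz operators along shifts, and passage to fibres. -/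

section Toeplitz

variable {n : ℕ} {E : Type*} [NormedAddCommGroup E] [InnerProductSpace ℂ E] [CompleteSpace E]

lemma MemLInfty.adjoint {Φ : Torus n → E →L[ℂ] E} (hΦ : MemLInfty Φ) :
    MemLInfty fun z => ContinuousLinearMap.adjoint (Φ z) where
  measurable := by
    refine hΦ.measurable.imp (fun h => ?_) fun ⟨hs, h⟩ => ⟨hs, fun x y => ?_⟩
    · exact (ContinuousLinearMap.adjoint (𝕜 := ℂ) (E := E)
        (F := E)).continuous.comp_aestronglyMeasurable h
    · refine (Complex.continuous_conj.measurable.comp_aemeasurable (h y x)).congr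
        (Eventually.of_forall fun z => ?_)
      simp [ContinuousLinearMap.adjoint_inner_left]
  bounded := by
    obtain ⟨C, hC⟩ := hΦ.bounded
    exact ⟨C, hC.mono fun z hz => by simpa using hz⟩

lemma inner_laurent_left {Φ : Torus n → E →L[ℂ] E} (hΦ : MemLInfty Φ) (f g : L2 n E) :
    inner ℂ (laurent Φ hΦ f) g = inner ℂ f (laurent _ hΦ.adjoint g) := by
  rw [L2.inner_def, L2.inner_def]
  refine integral_congr_ae ?_
  filter_upwards [coeFn_laurent hΦ f, coeFn_laurent hΦ.adjoint g] with z h1 h2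
  rw [h1, h2, ContinuousLinearMap.adjoint_inner_right]

lemma coe_toeplitz_apply {Φ : Torus n → E →L[ℂ] E} (hΦ : MemLInfty Φ) (f : hardySpace n E) :
    (toeplitz Φ hΦ f : L2 n E) = (hardySpace n E).starProjection (laurent Φ hΦ f) := rfl

/-- The projection is self-adjoint and fixes `H²`, so it drops out of both pairings. -/
lemma adjoint_toeplitz {Φ : Torus n → E →L[ℂ] E} (hΦ : MemLInfty Φ) :
    ContinuousLinearMap.adjoint (toeplitz Φ hΦ) = toeplitz _ hΦ.adjoint := by
  symm
  rw [ContinuousLinearMap.eq_adjoint_iff]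
  intro f g
  rw [Submodule.coe_inner, Submodule.coe_inner, coe_toeplitz_apply, coe_toeplitz_apply,
    Submodule.inner_starProjection_left_eq_right, ← Submodule.inner_starProjection_left_eq_right,
    ← Submodule.inner_starProjection_left_eq_right,
    Submodule.starProjection_eq_self_iff.2 f.2, Submodule.inner_starProjection_left_eq_right,
    Submodule.starProjection_eq_self_iff.2 g.2,
    ← inner_conj_symm, ← inner_laurent_left, inner_conj_symm]

/-- `(z₁ ⋯ zₙ)^m h` is asymptotically analytic. -/
lemma tendsto_starProjection_shift_sub (h : L2 n E) :
    Tendsto (fun m => (hardySpace n E).starProjection (shift m h) - shift m h) atTop (𝓝 0) := by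
  set P := (hardySpace n E).starProjection with hP
  let S : Submodule ℂ (L2 n E) :=
    { carrier := {h | Tendsto (fun m => P (shift m h) - shift m h) atTop (𝓝 0)}
      zero_mem' := by simp
      add_mem' := fun {f g} hf hg => by
        have := Tendsto.add hf hg
        rw [add_zero] at this
        refine this.congr fun m => ?_
        simp only [map_add]
        abel
      smul_mem' := fun c f hf => by
        have := Tendsto.const_smul hf c
        rw [smul_zero] at this
        refine this.congr fun m => ?_
        simp only [map_smul, smul_sub] }
  have hmono : Submodule.span ℂ {f : L2 n E | ∃ k η, f = fourierMonomial k η} ≤ S := by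
    refine Submodule.span_le.2 ?_
    rintro _ ⟨k, η, rfl⟩
    -- Once `m ≥ |k i|` for all `i`, the shifted monomial is analytic and the error is exactly `0`.
    have hev : ∀ᶠ m : ℕ in atTop, ∀ i, 0 ≤ (m : ℤ) + k i := by
      refine eventually_all.2 fun i => (eventually_ge_atTop (k i).natAbs).mono fun m hm => ?_
      omega
    refine tendsto_const_nhds.congr' (hev.mono fun m hm => ?_)
    beta_reduce
    rw [shift_fourierMonomial, Submodule.starProjection_eq_self_iff.2
      (fourierMonomial_mem_hardySpace (k := (fun _ => (m : ℤ)) + k) hm η), sub_self]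
  have hcl : IsClosed (S : Set (L2 n E)) := by
    refine isClosed_of_closure_subset fun f hf => ?_
    refine Metric.tendsto_nhds.2 fun ε hε => ?_
    -- Projection and shift are contractive, so replacing `f` by `g` costs at most `2‖f - g‖ < ε /
    -- 2`, uniformly in `m`.
    obtain ⟨g, hg, hfg⟩ := Metric.mem_closure_iff.1 hf (ε / 4) (by positivity)
    refine (Metric.tendsto_nhds.1 (show Tendsto _ _ _ from hg) (ε / 2) (by positivity)).mono
      fun m hm => ?_
    rw [dist_zero_right] at hm ⊢
    rw [dist_eq_norm] at hfg
    have h1 : ‖P (shift m (f - g))‖ ≤ ‖f - g‖ :=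
      (Submodule.norm_starProjection_apply_le _ _).trans (norm_shift m _).le
    have h2 : P (shift m f) - shift m f
        = P (shift m (f - g)) - shift m (f - g) + (P (shift m g) - shift m g) := by
      simp only [map_sub]; abel
    rw [h2]
    have h3 := norm_add_le (P (shift m (f - g)) - shift m (f - g)) (P (shift m g) - shift m g)
    have h4 := norm_sub_le (P (shift m (f - g))) (shift m (f - g))
    rw [norm_shift] at h4
    linarith
  have htop := Submodule.topologicalClosure_minimal _ hmono hcl
  rw [topologicalClosure_span_fourierMonomial] at htop
  exact htop (Submodule.mem_top (x := h))

/-- On vectors asymptotic to shifts of `g`, the Toeplitz operator is asymptotic to `L_Φ`. -/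
lemma tendsto_toeplitz_sub_shift {Φ : Torus n → E →L[ℂ] E} (hΦ : MemLInfty Φ)
    {a : ℕ → hardySpace n E} {g : L2 n E}
    (ha : Tendsto (fun m => (a m : L2 n E) - shift m g) atTop (𝓝 0)) :
    Tendsto (fun m => (toeplitz Φ hΦ (a m) : L2 n E) - shift m (laurent Φ hΦ g))
      atTop (𝓝 0) := by
  have h1 := (((hardySpace n E).starProjection ∘L laurent Φ hΦ).continuous.tendsto 0).comp ha
  have h2 := h1.add (tendsto_starProjection_shift_sub (laurent Φ hΦ g))
  rw [map_zero, add_zero] at h2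
  refine h2.congr fun m => ?_
  simp only [Function.comp_apply, ContinuousLinearMap.comp_apply, map_sub, laurent_shift,
    coe_toeplitz_apply]
  abel

/-- If `T_Φ` is a partial isometry then `L_Φ L_Φ* L_Φ = L_Φ` on constants. -/
lemma laurent_adjoint_laurent_const {Φ : Torus n → E →L[ℂ] E} (hΦ : MemLInfty Φ)
    (hT : IsPartialIsometry (toeplitz Φ hΦ)) (η : E) :
    laurent Φ hΦ (laurent _ hΦ.adjoint (laurent Φ hΦ (fourierMonomial 0 η)))
      = laurent Φ hΦ (fourierMonomial 0 η) := by
  set f : L2 n E := fourierMonomial 0 η with hf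
  have hmem : ∀ m : ℕ, shift m f ∈ hardySpace n E := fun m => by
    rw [hf, shift_fourierMonomial]
    exact fourierMonomial_mem_hardySpace (fun i => by simp) η
  have h0 : Tendsto (fun m => ((⟨shift m f, hmem m⟩ : hardySpace n E) : L2 n E) - shift m f)
      atTop (𝓝 0) := by simp
  have h1 := tendsto_toeplitz_sub_shift hΦ h0
  have h3 := tendsto_toeplitz_sub_shift hΦ (tendsto_toeplitz_sub_shift hΦ.adjoint h1)
  have h4 := (h1.sub h3).norm
  rw [sub_zero, norm_zero] at h4
  rw [← sub_eq_zero, ← norm_eq_zero]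
  -- The Toeplitz terms cancel by `T T* T = T`, leaving a shift of a fixed vector: its norm is
  -- independent of `m` and tends to `0`.
  refine tendsto_nhds_unique (tendsto_const_nhds.congr fun m => ?_) h4
  rw [← adjoint_toeplitz hΦ, hT.apply_adjoint_apply, sub_sub_sub_cancel_left, ← map_sub (shift m), norm_shift]

/-- A measurable, essentially bounded operator function vanishing a.e. on each vector vanishes
a.e. -/
lemma ae_eq_zero_of_forall_ae_apply_eq_zero {Ψ : Torus n → E →L[ℂ] E}
    (hm : AEStronglyMeasurable Ψ (torusMeasure n)) {C : ℝ}
    (hb : ∀ᵐ z ∂torusMeasure n, ‖Ψ z‖ ≤ C)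
    (h : ∀ x, ∀ᵐ z ∂torusMeasure n, Ψ z x = 0) : Ψ =ᵐ[torusMeasure n] 0 := by
  have hi : Integrable Ψ (torusMeasure n) := Integrable.of_bound hm C hb
  -- Evaluation at `x` commutes with the Bochner integral, so no union of null sets over `x` is
  -- needed.
  refine hi.ae_eq_zero_of_forall_setIntegral_eq_zero fun s _ _ => ?_
  ext x
  rw [ContinuousLinearMap.integral_apply hi.integrableOn, zero_apply]
  exact integral_eq_zero_of_ae (ae_restrict_of_ae (h x))

lemma ae_apply_adjoint_apply {Φ : Torus n → E →L[ℂ] E} (hΦ : MemLInfty Φ)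
    (hT : IsPartialIsometry (toeplitz Φ hΦ)) :
    ∀ᵐ z ∂torusMeasure n, ∀ x, Φ z (ContinuousLinearMap.adjoint (Φ z) (Φ z x)) = Φ z x := by
  have hx : ∀ x, ∀ᵐ z ∂torusMeasure n,
      Φ z (ContinuousLinearMap.adjoint (Φ z) (Φ z x)) = Φ z x := by
    intro x
    have h := laurent_adjoint_laurent_const hΦ hT x
    set f : L2 n E := fourierMonomial 0 x
    filter_upwards [coeFn_fourierMonomial (n := n) 0 x, coeFn_laurent hΦ f,
      coeFn_laurent hΦ.adjoint (laurent Φ hΦ f),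
      coeFn_laurent hΦ (laurent _ hΦ.adjoint (laurent Φ hΦ f))] with z h0 h1 h2 h3
    rw [UnitAddTorus.mFourier_zero, ContinuousMap.one_apply, one_smul] at h0
    rw [h, h2, h1, h0] at h3
    exact h3.symm
  -- The null set in `hx` depends on `x`. In the Bochner case, integrals of the operator-valued
  -- defect remove this dependence; in the separable case, a dense sequence and continuity in `x`
  -- do.
  rcases hΦ.measurable with hm | ⟨hs, -⟩
  · obtain ⟨C, hC⟩ := hΦ.bounded
    have hm' : AEStronglyMeasurable
        (fun z => Φ z ∘L ContinuousLinearMap.adjoint (Φ z) ∘L Φ z - Φ z) (torusMeasure n) := by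
      have hc : Continuous fun A : E →L[ℂ] E => A ∘L ContinuousLinearMap.adjoint A ∘L A - A :=
        (continuous_id.clm_comp ((ContinuousLinearMap.adjoint (𝕜 := ℂ) (E := E)
          (F := E)).continuous.clm_comp continuous_id)).sub continuous_id
      exact hc.comp_aestronglyMeasurable hm
    have hb : ∀ᵐ z ∂torusMeasure n,
        ‖Φ z ∘L ContinuousLinearMap.adjoint (Φ z) ∘L Φ z - Φ z‖ ≤ C * (C * C) + C := by
      filter_upwards [hC] with z hz
      have hC0 : 0 ≤ C := (norm_nonneg _).trans hz
      have hz' : ‖ContinuousLinearMap.adjoint (Φ z)‖ ≤ C := by simpa using hz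
      refine (norm_sub_le _ _).trans (add_le_add ?_ hz)
      refine (ContinuousLinearMap.opNorm_comp_le _ _).trans ?_
      gcongr
      refine (ContinuousLinearMap.opNorm_comp_le _ _).trans ?_
      gcongr
    have h0 := ae_eq_zero_of_forall_ae_apply_eq_zero hm' hb
      fun x => (hx x).mono fun z hz => by simp [hz]
    filter_upwards [h0] with z hz x
    have := DFunLike.congr_fun hz x
    simpa [sub_eq_zero] using this
  · have hd := ae_all_iff.2 fun i => hx (TopologicalSpace.denseSeq E i)
    filter_upwards [hd] with z hz
    exact congrFun ((TopologicalSpace.denseRange_denseSeq E).equalizer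
      (g := fun x => Φ z (ContinuousLinearMap.adjoint (Φ z) (Φ z x))) (h := fun x => Φ z x)
      (by fun_prop) (by fun_prop) (funext hz))

end Toeplitz

end ToeplitzPolydisc

end

theorem corollary4p3 {n : ℕ} {E : Type*} [NormedAddCommGroup E] [InnerProductSpace ℂ E]
    [CompleteSpace E] (Φ : ToeplitzPolydisc.Torus n → E →L[ℂ] E)
    (hΦ : ToeplitzPolydisc.MemLInfty Φ)
    (hT : ToeplitzPolydisc.IsPartialIsometry (ToeplitzPolydisc.toeplitz Φ hΦ)) :
    ∀ᵐ z ∂(ToeplitzPolydisc.torusMeasure n), ToeplitzPolydisc.IsPartialIsometry (Φ z) :=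
  (ToeplitzPolydisc.ae_apply_adjoint_apply hΦ hT).mono fun _ hz =>
    ToeplitzPolydisc.isPartialIsometry_of_apply_adjoint_apply hz
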